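/- Let $k$ be a field of prime characteristic $p>0$ and let $$R=\frac{k[t,u,v,w,x,y,z]}{(u^2x^2+v^2y^2+tuxvy+tw^2z^2)}.$$ Then the set $$\bigcup_{q=p^e,\ e\in\mathbb{N}} \operatorname{Ass}_R \frac{R}{(u^q,v^q,w^q,x^q,y^q,z^q)}$$ of prime ideals of $R$ is infinite; moreover, it has infinitely many elements that are maximal (with respect to inclusion) among the elements of this set. -/

import Mathlib

noncomputable section

namespace SinghSwanson

/-- The polynomial `u²x² + v²y² + tuxvy + tw²z²` in `k[t,u,v,w,x,y,z]`, where the variables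
`t, u, v, w, x, y, z` are `X 0, X 1, X 2, X 3, X 4, X 5, X 6` in this order. -/
def equation (k : Type*) [Field k] : MvPolynomial (Fin 7) k :=
  let t := MvPolynomial.X 0
  let u := MvPolynomial.X 1
  let v := MvPolynomial.X 2
  let w := MvPolynomial.X 3
  let x := MvPolynomial.X 4
  let y := MvPolynomial.X 5
  let z := MvPolynomial.X 6
  u ^ 2 * x ^ 2 + v ^ 2 * y ^ 2 + t * u * x * v * y + t * w ^ 2 * z ^ 2

/-- The hypersurface ring `R = k[t,u,v,w,x,y,z] / (u²x² + v²y² + tuxvy + tw²z²)`. -/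
abbrev HypersurfaceRing (k : Type*) [Field k] : Type _ :=
  MvPolynomial (Fin 7) k ⧸ Ideal.span {equation k}

/-- The class in `R` of the `i`-th variable, in the order `t, u, v, w, x, y, z`. -/
def coord (k : Type*) [Field k] (i : Fin 7) : HypersurfaceRing k :=
  Ideal.Quotient.mk (Ideal.span {equation k}) (MvPolynomial.X i)

/-- The ideal `(u^q, v^q, w^q, x^q, y^q, z^q)` of `R`. -/
def powerIdeal (k : Type*) [Field k] (q : ℕ) : Ideal (HypersurfaceRing k) :=
  Ideal.span {coord k 1 ^ q, coord k 2 ^ q, coord k 3 ^ q,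
    coord k 4 ^ q, coord k 5 ^ q, coord k 6 ^ q}

/-- The union over all `q = p^e`, `e ∈ ℕ`, of the sets of associated primes of the `R`-module
`R / (u^q, v^q, w^q, x^q, y^q, z^q)`. -/
def assUnion (k : Type*) [Field k] (p : ℕ) : Set (Ideal (HypersurfaceRing k)) :=
  ⋃ e : ℕ, associatedPrimes (HypersurfaceRing k) (HypersurfaceRing k ⧸ powerIdeal k (p ^ e))

end SinghSwanson

end

/-!
Multiplying the equation of the hypersurface by `w^(q-1)` kills, modulo `w^q`, its last term, and so
the equation becomes a three-term recurrence with middle coefficient `t` for the elements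
`(ux)ⁱ(vy)ʲ(uv)ᶜw^(q-1)` with `i + j = n` and `c + n = q`. Its solutions are governed by the
Chebyshev polynomials `S`, and since the two ends `i = 0` and `j = 0` of the chain lie in
`(u^q, v^q)`, the element `S_{n-1}(-t)` kills the class of the `i = 1` element. A functional built
from the values `S_{i-1}(r)` at a root `r` of `S_{n-1}` shows that this class is nonzero. Hence some
associated prime contains `S_{n-1}(-t)`; as it also contains `u, v, w, x, y, z`, it is a maximal
ideal. Primes obtained in this way for coprime values of `n` are distinct, because `{n | S_{n-1}(-t)
∈ I}` is a subgroup of `ℤ` for every ideal `I`, and it contains `1` only if `I` is the unit ideal.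
-/

open Polynomial.Chebyshev (S)

namespace SinghSwanson

section Chebyshev

open Polynomial

variable {A : Type*} [CommRing A]

theorem S_add (m n : ℤ) : S A (m + n) = S A m * S A n - S A (m - 1) * S A (n - 1) := by
  induction n using Polynomial.Chebyshev.induct with
  | zero => simp
  | one => simp [Chebyshev.S_add_one, mul_comm]
  | add_two n ih₁ ih₀ =>
    have hmn := Chebyshev.S_add_two A (m + n)
    have hn := Chebyshev.S_add_two A n
    have hn' := Chebyshev.S_add_one A n
    rw [← add_assoc] at ih₁ ⊢
    rw [show (n : ℤ) + 2 - 1 = n + 1 by ring]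
    rw [show (n : ℤ) + 1 - 1 = n by ring] at ih₁
    linear_combination hmn + X * ih₁ - ih₀ - S A m * hn + S A (m - 1) * hn'
  | neg_add_one n ih₀ ih₁ =>
    have hmn := Chebyshev.S_sub_one A (m - n)
    have hn := Chebyshev.S_sub_one A (-n)
    have hn' := Chebyshev.S_sub_two A (-n)
    rw [show m + (-(n : ℤ) - 1) = m - n - 1 by ring, show -(n : ℤ) - 1 - 1 = -n - 2 by ring]
    rw [show m + -(n : ℤ) = m - n by ring] at ih₀
    rw [show m + (-(n : ℤ) + 1) = m - n + 1 by ring, add_sub_cancel_right] at ih₁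
    linear_combination hmn + X * ih₀ - ih₁ - S A m * hn + S A (m - 1) * hn'

theorem isMonicOfDegree_S [Nontrivial A] (n : ℕ) : IsMonicOfDegree (S A n) n := by
  induction n using Nat.twoStepInduction with
  | zero => simp
  | one => simpa using isMonicOfDegree_X A
  | more n ih₀ ih₁ =>
    push_cast at ih₁ ⊢
    rw [Chebyshev.S_add_two, show n + 2 = 1 + (n + 1) by ring]
    exact ((isMonicOfDegree_X A).mul ih₁).sub (by rw [ih₀.natDegree_eq]; lia)

theorem eval_S_add_one (x : A) (n : ℤ) :
    (S A (n + 1)).eval x = x * (S A n).eval x - (S A (n - 1)).eval x := by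
  rw [Chebyshev.S_add_one, eval_sub, eval_mul, eval_X]

theorem isAlgebraic_of_eval_S_mem {R : Type*} [CommRing R] [Nontrivial R] [Algebra R A]
    {I : Ideal A} {x : A} {n : ℕ} (h : (S A n).eval x ∈ I) :
    IsAlgebraic R (Ideal.Quotient.mk I x) := by
  refine ⟨S R n, (isMonicOfDegree_S n).ne_zero, ?_⟩
  rw [Chebyshev.aeval_S, ← Ideal.Quotient.algebraMap_eq, ← Chebyshev.algebraMap_eval_S]
  exact Ideal.Quotient.eq_zero_iff_mem.2 h

/-- The integers `n` with `Sₙ₋₁(x) ∈ I`. They form a subgroup because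
`Sₘ₊ₙ₋₁ = Sₘ Sₙ₋₁ - Sₘ₋₁ Sₙ₋₂` and `S₋ₙ₋₁ = -Sₙ₋₁`. -/
def chebyshevVanishingSubgroup (I : Ideal A) (x : A) : AddSubgroup ℤ where
  carrier := {n | (S A (n - 1)).eval x ∈ I}
  zero_mem' := by simp
  add_mem' {m n} hm hn := by
    rw [Set.mem_ofPred_eq, add_sub_assoc, S_add, eval_sub, eval_mul, eval_mul]
    exact sub_mem (I.mul_mem_left _ hn) (I.mul_mem_right _ hm)
  neg_mem' {n} hn := by
    rw [Set.mem_ofPred_eq, Chebyshev.S_neg_sub_one, eval_neg]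
    exact neg_mem hn

theorem mem_chebyshevVanishingSubgroup {I : Ideal A} {x : A} {n : ℤ} :
    n ∈ chebyshevVanishingSubgroup I x ↔ (S A (n - 1)).eval x ∈ I :=
  Iff.rfl

theorem eq_top_of_isCoprime_of_eval_S_mem {I : Ideal A} {x : A} {m n : ℤ} (hmn : IsCoprime m n)
    (hm : (S A (m - 1)).eval x ∈ I) (hn : (S A (n - 1)).eval x ∈ I) : I = ⊤ := by
  obtain ⟨a, b, hab⟩ := hmn
  have one_mem : (1 : ℤ) ∈ chebyshevVanishingSubgroup I x := by
    rw [← hab, ← smul_eq_mul, ← smul_eq_mul]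
    exact add_mem (zsmul_mem (mem_chebyshevVanishingSubgroup.2 hm) a)
      (zsmul_mem (mem_chebyshevVanishingSubgroup.2 hn) b)
  rw [Ideal.eq_top_iff_one]
  simpa using mem_chebyshevVanishingSubgroup.1 one_mem

theorem sub_eval_S_mul_mem {I : Ideal A} {x : A} {m : ℕ → A} {n : ℕ} (h₀ : m 0 ∈ I)
    (hrec : ∀ j, j + 2 ≤ n → m (j + 2) - x * m (j + 1) + m j ∈ I) {j : ℕ} (hj : j ≤ n) :
    m j - (S A (j - 1)).eval x * m 1 ∈ I := by
  induction j using Nat.twoStepInduction with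
  | zero => simpa using h₀
  | one => simp
  | more j ih₀ ih₁ =>
    have key := add_mem (sub_mem (hrec j hj) (ih₀ (by lia))) (I.mul_mem_left x (ih₁ (by lia)))
    have hS := eval_S_add_one x j
    push_cast at key ⊢
    rw [add_sub_cancel_right] at key
    rw [show (j : ℤ) + 2 - 1 = j + 1 by ring]
    convert! key using 1
    linear_combination -m 1 * hS

end Chebyshev

section CommutativeAlgebra

variable {A : Type*} [CommRing A] {k : Type*} [Field k] [Algebra k A]

theorem exists_mem_associatedPrimes_of_mul_mem [IsNoetherianRing A] {I : Ideal A} {a b : A}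
    (hb : b ∉ I) (hab : a * b ∈ I) : ∃ P ∈ associatedPrimes A (A ⧸ I), a ∈ P := by
  obtain ⟨P, hP, hle⟩ := exists_le_isAssociatedPrime_of_isNoetherianRing A
    (Ideal.Quotient.mk I b) (Ideal.Quotient.eq_zero_iff_mem.not.2 hb)
  refine ⟨P, hP, hle ?_⟩
  rw [Submodule.mem_colon_singleton, Submodule.mem_bot]
  exact Ideal.Quotient.eq_zero_iff_mem.2 hab

theorem le_of_mem_associatedPrimes_quotient {I P : Ideal A}
    (hP : P ∈ associatedPrimes A (A ⧸ I)) : I ≤ P := by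
  simpa only [Submodule.annihilator_top, Ideal.annihilator_quotient] using
    IsAssociatedPrime.annihilator_le hP

theorem isMaximal_of_isAlgebraic_of_adjoin_eq_top {s : Set A} (hs : Algebra.adjoin k s = ⊤)
    {P : Ideal A} [P.IsPrime] (h : ∀ x ∈ s, IsAlgebraic k (Ideal.Quotient.mk P x)) :
    P.IsMaximal := by
  have hle : Algebra.adjoin k s ≤
      (integralClosure k (A ⧸ P)).comap (Ideal.Quotient.mkₐ k P) :=
    Algebra.adjoin_le fun x hx => (h x hx).isIntegral
  have : Algebra.IsIntegral k (A ⧸ P) := ⟨fun y => by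
    obtain ⟨x, rfl⟩ := Ideal.Quotient.mk_surjective y
    exact hle (hs ▸ Algebra.mem_top)⟩
  exact Ideal.Quotient.maximal_of_isField P
    (isField_of_isIntegral_of_isField' (Field.toIsField k))

end CommutativeAlgebra

theorem map_eq_zero_of_mem_ideal_span {R A M : Type*} [Semiring R] [Semiring A] [Module R A]
    [IsScalarTower R A A] [AddCommMonoid M] [Module R M] (φ : A →ₗ[R] M) {b s : Set A}
    (hb : Submodule.span R b = ⊤) (h : ∀ a ∈ b, ∀ g ∈ s, φ (a * g) = 0) {f : A}
    (hf : f ∈ Ideal.span s) : φ f = 0 := by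
  rw [Ideal.span, ← Submodule.restrictScalars_mem R,
    ← Submodule.span_smul_of_span_eq_top hb s] at hf
  refine (Submodule.span_le (p := LinearMap.ker φ)).2 ?_ hf
  rintro _ ⟨a, ha, g, hg, rfl⟩
  exact h a ha g hg

variable {k : Type*} [Field k]

section HypersurfaceRing

theorem coord_relation : coord k 1 ^ 2 * coord k 4 ^ 2 + coord k 2 ^ 2 * coord k 5 ^ 2 +
    coord k 0 * coord k 1 * coord k 4 * coord k 2 * coord k 5 +
      coord k 0 * coord k 3 ^ 2 * coord k 6 ^ 2 = 0 := by
  simpa only [equation, map_add, map_mul, map_pow] using!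
    Ideal.Quotient.mk_singleton_self (equation k)

theorem adjoin_range_coord : Algebra.adjoin k (Set.range (coord k)) = ⊤ := by
  have hrange : Set.range (coord k) =
      Ideal.Quotient.mkₐ k (Ideal.span {equation k}) '' Set.range MvPolynomial.X := by
    rw [← Set.range_comp]
    rfl
  rw [hrange, ← AlgHom.map_adjoin, MvPolynomial.adjoin_range_X, Algebra.map_top,
    AlgHom.range_eq_top]
  exact Ideal.Quotient.mkₐ_surjective _ _

theorem powerIdeal_eq_span_image (q : ℕ) :
    powerIdeal k q = Ideal.span ((coord k · ^ q) '' {0}ᶜ) := by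
  have hcompl : ({0}ᶜ : Set (Fin 7)) = {1, 2, 3, 4, 5, 6} := by
    ext i
    fin_cases i <;> simp
  simp only [powerIdeal, hcompl, Set.image_insert_eq, Set.image_singleton]

theorem coord_pow_mem_powerIdeal (q : ℕ) {i : Fin 7} (hi : i ≠ 0) :
    coord k i ^ q ∈ powerIdeal k q := by
  rw [powerIdeal_eq_span_image]
  exact Ideal.subset_span (Set.mem_image_of_mem _ hi)

theorem mk_mem_powerIdeal_iff {q : ℕ} {f : MvPolynomial (Fin 7) k} :
    Ideal.Quotient.mk (Ideal.span {equation k}) f ∈ powerIdeal k q ↔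
      f ∈ Ideal.span ((MvPolynomial.X · ^ q) '' {0}ᶜ ∪ {equation k}) := by
  have hmap : powerIdeal k q = (Ideal.span ((MvPolynomial.X · ^ q) '' {0}ᶜ)).map
      (Ideal.Quotient.mk (Ideal.span {equation k})) := by
    simp only [powerIdeal_eq_span_image, Ideal.map_span, Set.image_image, map_pow, coord]
  rw [hmap, Ideal.mem_quotient_iff_mem_sup, Ideal.span_union]

theorem coord_mem_of_mem_associatedPrimes {q : ℕ} {P : Ideal (HypersurfaceRing k)}
    (hP : P ∈ associatedPrimes (HypersurfaceRing k) (HypersurfaceRing k ⧸ powerIdeal k q))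
    {i : Fin 7} (hi : i ≠ 0) : coord k i ∈ P :=
  (IsAssociatedPrime.isPrime hP).mem_of_pow_mem q
    (le_of_mem_associatedPrimes_quotient hP (coord_pow_mem_powerIdeal q hi))

theorem isMaximal_of_mem_associatedPrimes {q : ℕ} {P : Ideal (HypersurfaceRing k)}
    (hP : P ∈ associatedPrimes (HypersurfaceRing k) (HypersurfaceRing k ⧸ powerIdeal k q))
    (ht : IsAlgebraic k (Ideal.Quotient.mk P (coord k 0))) : P.IsMaximal := by
  have : P.IsPrime := IsAssociatedPrime.isPrime hP
  refine isMaximal_of_isAlgebraic_of_adjoin_eq_top adjoin_range_coord ?_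
  rintro _ ⟨i, rfl⟩
  obtain rfl | hi := eq_or_ne i 0
  · exact ht
  · rw [Ideal.Quotient.eq_zero_iff_mem.2 (coord_mem_of_mem_associatedPrimes hP hi)]
    exact isAlgebraic_zero

end HypersurfaceRing

section Chain

variable (k) in
/-- The chain of elements `(ux)ⁱ (vy)ʲ (uv)ᶜ w^(q-1)`, where `q = c + i + j`, on which the equation
of the hypersurface acts, modulo `(u^q, v^q, w^q)`, as a three-term recurrence. -/
noncomputable def chainElement (c i j : ℕ) : HypersurfaceRing k :=
  coord k 1 ^ (c + i) * coord k 2 ^ (c + j) * coord k 3 ^ (c + i + j - 1) * coord k 4 ^ i *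
    coord k 5 ^ j

theorem chainElement_recurrence_mem (c i j : ℕ) :
    chainElement k c (i + 2) j - -coord k 0 * chainElement k c (i + 1) (j + 1) +
      chainElement k c i (j + 2) ∈ powerIdeal k (c + i + j + 2) := by
  have hw := coord_pow_mem_powerIdeal (k := k) (c + i + j + 2) (i := 3) (by decide)
  convert! Ideal.mul_mem_left _ (-(coord k 0 * coord k 1 ^ (c + i) * coord k 2 ^ (c + j) *
    coord k 3 * coord k 4 ^ i * coord k 5 ^ j * coord k 6 ^ 2)) hw using 1
  simp only [chainElement, show c + (i + 2) + j - 1 = c + i + j + 1 by lia,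
    show c + (i + 1) + (j + 1) - 1 = c + i + j + 1 by lia,
    show c + i + (j + 2) - 1 = c + i + j + 1 by lia]
  linear_combination coord k 1 ^ (c + i) * coord k 2 ^ (c + j) * coord k 3 ^ (c + i + j + 1) *
    coord k 4 ^ i * coord k 5 ^ j * coord_relation (k := k)

theorem chainElement_zero_left_mem (c j : ℕ) : chainElement k c 0 j ∈ powerIdeal k (c + j) :=
  Ideal.mul_mem_right _ _ <| Ideal.mul_mem_right _ _ <| Ideal.mul_mem_right _ _ <|
    Ideal.mul_mem_left _ _ (coord_pow_mem_powerIdeal _ (by decide))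

theorem chainElement_zero_right_mem (c i : ℕ) : chainElement k c i 0 ∈ powerIdeal k (c + i) :=
  Ideal.mul_mem_right _ _ <| Ideal.mul_mem_right _ _ <| Ideal.mul_mem_right _ _ <|
    Ideal.mul_mem_right _ _ (coord_pow_mem_powerIdeal _ (by decide))

theorem eval_S_mul_chainElement_mem (c n : ℕ) :
    (S (HypersurfaceRing k) n).eval (-coord k 0) * chainElement k c 1 n ∈
      powerIdeal k (c + n + 1) := by
  have hrec (j : ℕ) (hj : j + 2 ≤ n + 1) :
      chainElement k c (j + 2) (n + 1 - (j + 2)) -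
        -coord k 0 * chainElement k c (j + 1) (n + 1 - (j + 1)) +
          chainElement k c j (n + 1 - j) ∈ powerIdeal k (c + n + 1) := by
    obtain ⟨l, rfl⟩ : ∃ l, n = j + l + 1 := ⟨n - j - 1, by lia⟩
    rw [show j + l + 1 + 1 - (j + 2) = l by lia, show j + l + 1 + 1 - (j + 1) = l + 1 by lia,
      show j + l + 1 + 1 - j = l + 2 by lia, show c + (j + l + 1) + 1 = c + j + l + 2 by lia]
    exact chainElement_recurrence_mem c j l
  have hlast := sub_eval_S_mul_mem (m := fun j => chainElement k c j (n + 1 - j))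
    (chainElement_zero_left_mem c (n + 1)) hrec le_rfl
  simpa [← add_assoc] using sub_mem (chainElement_zero_right_mem (k := k) c (n + 1)) hlast

end Chain

section ChainFunctional

variable {K : Type*} [CommRing K]

/-- The functional detecting `chainElement`, on exponent vectors: `tʰ (ux)ⁱ (vy)ʲ (uv)ᶜ w^(q-1)`,
where `i + j = n` and `q = c + n`, has weight `(-r)ʰ Sᵢ₋₁(r)`, and every other monomial has
weight `0`. -/
noncomputable def chainWeight (c n : ℕ) (r : K) (d : Fin 7 →₀ ℕ) : K :=
  if d 1 = c + d 4 ∧ d 2 = c + d 5 ∧ d 3 + 1 = c + n ∧ d 4 + d 5 = n ∧ d 6 = 0 then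
    (-r) ^ d 0 * (S K (d 4 - 1)).eval r
  else 0

theorem chainWeight_eq_zero_of_le {c n : ℕ} (hn : 0 < n) {r : K} (hr : (S K (n - 1)).eval r = 0)
    {d : Fin 7 →₀ ℕ} {i : Fin 7} (hi : i ≠ 0) (hd : c + n ≤ d i) : chainWeight c n r d = 0 := by
  rw [chainWeight]
  split_ifs with h
  · have hends : d 4 = n ∨ d 4 = 0 := by
      fin_cases i
      · exact absurd rfl hi
      all_goals simp only [Fin.reduceFinMk, Fin.isValue, Fin.mk_one] at hd; lia
    obtain hd₄ | hd₄ := hends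
    · rw [hd₄, hr, mul_zero]
    · simp [hd₄]
  · rfl

open Finsupp (single)

theorem chainWeight_recurrence (c n : ℕ) (r : K) (d : Fin 7 →₀ ℕ) :
    chainWeight c n r (d + single 1 2 + single 4 2) +
      chainWeight c n r (d + single 2 2 + single 5 2) +
      chainWeight c n r (d + single 0 1 + single 1 1 + single 4 1 + single 2 1 + single 5 1) +
      chainWeight c n r (d + single 0 1 + single 3 2 + single 6 2) = 0 := by
  simp only [chainWeight, Finsupp.coe_add, Pi.add_apply, Finsupp.single_apply, Fin.reduceEq,
    ↓reduceIte, add_zero]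
  by_cases h : d 1 + 2 = c + (d 4 + 2) ∧ d 2 = c + d 5 ∧ d 3 + 1 = c + n ∧ d 4 + 2 + d 5 = n ∧
      d 6 = 0
  · rw [if_pos h, if_pos (by lia), if_pos (by lia), if_neg (by lia)]
    have hS := eval_S_add_one r (d 4)
    push_cast
    rw [show (d 4 : ℤ) + 2 - 1 = d 4 + 1 by ring, add_sub_cancel_right]
    linear_combination (-r) ^ d 0 * hS
  · rw [if_neg h, if_neg (by lia), if_neg (by lia), if_neg (by lia)]
    simp only [add_zero]

theorem chainElement_eq_mk_monomial (c i j : ℕ) :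
    chainElement k c i j = Ideal.Quotient.mk (Ideal.span {equation k})
      (MvPolynomial.monomial (single 1 (c + i) + single 2 (c + j) + single 3 (c + i + j - 1) +
        single 4 i + single 5 j) 1) := by
  rw [← zero_add (single (1 : Fin 7) (c + i))]
  simp only [MvPolynomial.monomial_add_single, chainElement, coord, map_mul, map_pow,
    MvPolynomial.monomial_zero', map_one, one_mul]

variable [Algebra k K]

variable (k) in
/-- The `k`-linear extension of `chainWeight`. -/
noncomputable def chainFunctional (c n : ℕ) (r : K) : MvPolynomial (Fin 7) k →ₗ[k] K :=
  (MvPolynomial.basisMonomials (Fin 7) k).constr k (chainWeight c n r)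

theorem chainFunctional_monomial (c n : ℕ) (r : K) (d : Fin 7 →₀ ℕ) :
    chainFunctional k c n r (MvPolynomial.monomial d 1) = chainWeight c n r d :=
  (MvPolynomial.basisMonomials (Fin 7) k).constr_basis k _ d

theorem chainFunctional_monomial_mul_equation (c n : ℕ) (r : K) (d : Fin 7 →₀ ℕ) :
    chainFunctional k c n r (MvPolynomial.monomial d 1 * equation k) = 0 := by
  have hexpand : MvPolynomial.monomial d 1 * equation k =
      MvPolynomial.monomial (d + single 1 2 + single 4 2) 1 +
      MvPolynomial.monomial (d + single 2 2 + single 5 2) 1 +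
      MvPolynomial.monomial
        (d + single 0 1 + single 1 1 + single 4 1 + single 2 1 + single 5 1) 1 +
      MvPolynomial.monomial (d + single 0 1 + single 3 2 + single 6 2) 1 := by
    simp only [MvPolynomial.monomial_add_single, equation]
    ring
  simp only [hexpand, map_add, chainFunctional_monomial]
  exact chainWeight_recurrence c n r d

theorem chainFunctional_eq_zero_of_mk_mem_powerIdeal {c n : ℕ} (hn : 0 < n) {r : K}
    (hr : (S K (n - 1)).eval r = 0) {f : MvPolynomial (Fin 7) k}
    (hf : Ideal.Quotient.mk (Ideal.span {equation k}) f ∈ powerIdeal k (c + n)) :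
    chainFunctional k c n r f = 0 := by
  refine map_eq_zero_of_mem_ideal_span _ (MvPolynomial.basisMonomials (Fin 7) k).span_eq ?_
    (mk_mem_powerIdeal_iff.1 hf)
  rintro _ ⟨d, rfl⟩ _ (⟨i, hi, rfl⟩ | rfl)
  · rw [MvPolynomial.coe_basisMonomials, ← MvPolynomial.monomial_add_single,
      chainFunctional_monomial]
    exact chainWeight_eq_zero_of_le hn hr hi (by simp)
  · exact chainFunctional_monomial_mul_equation c n r d

end ChainFunctional

theorem chainElement_one_notMem_powerIdeal (c : ℕ) {n : ℕ} (hn : n ≠ 0) :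
    chainElement k c 1 n ∉ powerIdeal k (c + n + 1) := by
  intro hmem
  obtain ⟨r, hr⟩ := IsAlgClosed.exists_root (S (AlgebraicClosure k) n) (by
    rw [Polynomial.degree_eq_natDegree (isMonicOfDegree_S n).ne_zero,
      (isMonicOfDegree_S n).natDegree_eq]
    exact_mod_cast hn)
  rw [chainElement_eq_mk_monomial, add_assoc c n 1] at hmem
  have hzero := chainFunctional_eq_zero_of_mk_mem_powerIdeal n.succ_pos (r := r) (by simpa using hr)
    hmem
  rw [chainFunctional_monomial, chainWeight,
    if_pos (by simp [add_right_comm c 1 n, add_comm 1 n, add_assoc])] at hzero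
  simp at hzero

theorem exists_mem_associatedPrimes_powerIdeal {n q : ℕ} (hn : n ≠ 0) (hnq : n < q) :
    ∃ P ∈ associatedPrimes (HypersurfaceRing k) (HypersurfaceRing k ⧸ powerIdeal k q),
      (S (HypersurfaceRing k) n).eval (-coord k 0) ∈ P := by
  obtain ⟨c, rfl⟩ := Nat.exists_eq_add_of_le' hnq
  exact exists_mem_associatedPrimes_of_mul_mem (chainElement_one_notMem_powerIdeal c hn)
    (eval_S_mul_chainElement_mem c n)

theorem exists_maximal_mem_iUnion_associatedPrimes {Q : Set ℕ} (hQ : Q.Infinite) {n : ℕ}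
    (hn : n ≠ 0) :
    ∃ P : Ideal (HypersurfaceRing k),
      Maximal (· ∈ ⋃ q ∈ Q, associatedPrimes (HypersurfaceRing k)
        (HypersurfaceRing k ⧸ powerIdeal k q)) P ∧
      (S (HypersurfaceRing k) n).eval (-coord k 0) ∈ P := by
  obtain ⟨q, hqQ, hnq⟩ := hQ.exists_gt n
  obtain ⟨P, hP, hSP⟩ := exists_mem_associatedPrimes_powerIdeal (k := k) hn hnq
  have ht : IsAlgebraic k (Ideal.Quotient.mk P (coord k 0)) := by
    simpa using (isAlgebraic_of_eval_S_mem (R := k) hSP).neg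
  have hmax := isMaximal_of_mem_associatedPrimes hP ht
  refine ⟨P, ⟨Set.mem_biUnion hqQ hP, fun P' hP' hle => ?_⟩, hSP⟩
  obtain ⟨q', -, hPq'⟩ := Set.mem_iUnion₂.1 hP'
  exact (hmax.eq_of_le (IsAssociatedPrime.isPrime hPq').ne_top hle).ge

end SinghSwanson

open SinghSwanson in
theorem mainTheorem6_general (k : Type*) [Field k] {Q : Set ℕ} (hQ : Q.Infinite) :
    (⋃ q ∈ Q, associatedPrimes (HypersurfaceRing k)
      (HypersurfaceRing k ⧸ powerIdeal k q)).Infinite ∧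
    {P : Ideal (HypersurfaceRing k) |
      Maximal (· ∈ ⋃ q ∈ Q, associatedPrimes (HypersurfaceRing k)
        (HypersurfaceRing k ⧸ powerIdeal k q)) P}.Infinite := by
  choose P hmax hSP using fun l : Nat.Primes =>
    exists_maximal_mem_iUnion_associatedPrimes (k := k) hQ (Nat.sub_ne_zero_of_lt l.2.one_lt)
  have hinj : Function.Injective P := by
    intro l l' hll'
    by_contra hne
    obtain ⟨q, -, hq⟩ := Set.mem_iUnion₂.1 (hmax l).prop
    have hcoprime : IsCoprime (l : ℤ) (l' : ℤ) :=
      Nat.isCoprime_iff_coprime.2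
        ((Nat.coprime_primes l.2 l'.2).2 fun h => hne (Subtype.ext h))
    have hSl := hSP l
    have hSl' := hll' ▸ hSP l'
    rw [Nat.cast_pred l.2.pos] at hSl
    rw [Nat.cast_pred l'.2.pos] at hSl'
    exact (IsAssociatedPrime.isPrime hq).ne_top
      (eq_top_of_isCoprime_of_eval_S_mem hcoprime hSl hSl')
  have hinf := Set.infinite_of_injective_forall_mem (s := {P | Maximal _ P}) hinj hmax
  exact ⟨hinf.mono fun _ hP => hP.prop, hinf⟩

theorem mainTheorem6 (k : Type*) [Field k] (p : ℕ) (hp : p.Prime) [CharP k p] :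
    (SinghSwanson.assUnion k p).Infinite ∧
      {P : Ideal (SinghSwanson.HypersurfaceRing k) |
        Maximal (fun Q => Q ∈ SinghSwanson.assUnion k p) P}.Infinite := by
  simpa only [Set.biUnion_range] using!
    mainTheorem6_general k (Set.infinite_range_of_injective (Nat.pow_right_injective hp.two_le))
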